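/- Let $\mathsf{K}$ be a variety of commutative monoids, that is, a class of commutative monoids $\langle M;\cdot,1\rangle$ closed under homomorphic images, submonoids (containing $1$), and arbitrary direct products. Let $B\in\mathsf{K}$, let $A$ be a submonoid of $B$, and let $b\in B$. The dominion of $A$ in $B$ relative to $\mathsf{K}$ is $$\mathsf{d}_{\mathsf{K}}(A,B)=\{c\in B : g(c)=h(c)\text{ for all }C\in\mathsf{K}\text{ and all monoid homomorphisms }g,h\colon B\to C\text{ with }g{\upharpoonright}_A=h{\upharpoonright}_A\}.$$ For $n\ge 1$ the $n$-th Isbell formula $\varphi_n(x_1,\dots,x_{2n+1},y)$ states that there exist $z_1,\dots,z_n,w_1,\dots,w_n$ such that $$y=x_1z_1,\qquad x_1=w_1x_2,\qquad x_{2n}z_n=x_{2n+1},\qquad w_nx_{2n+1}=y,$$ and, for every $i=1,\dots,n-1$, $$x_{2i}z_i=x_{2i+1}z_{i+1},\qquad w_ix_{2i+1}=w_{i+1}x_{2(i+1)};$$ and $\varphi_0(x_1,y)$ is the equation $x_1=y$. Then $b\in\mathsf{d}_{\mathsf{K}}(A,B)$ if and only if there exist $n\in\mathbb{N}$ (with $0\in\mathbb{N}$)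 and $a_1,\dots,a_{2n+1}\in A$ such that $\varphi_n(a_1,\dots,a_{2n+1},b)$ holds in $B$ (that is, with the witnesses $z_i,w_i$ taken in $B$). -/

import Mathlib

universe u

/-- A class of commutative monoids, given as a predicate on commutative monoids. -/
abbrev CMonClass : Type (u + 1) := ∀ (M : Type u) [CommMonoid M], Prop

/-- A class of commutative monoids is a variety when it is closed under homomorphic images,
subalgebras, and arbitrary direct products (of set-indexed families, including the empty one).
Closure under isomorphic copies is a special case of closure under homomorphic images. -/
structure CMonClass.IsVariety (K : CMonClass.{u}) : Prop where
  /-- Closure under homomorphic images. -/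
  closed_H : ∀ (M N : Type u) [CommMonoid M] [CommMonoid N] (f : M →* N),
    Function.Surjective f → K M → K N
  /-- Closure under subalgebras, that is, under submonoids. -/
  closed_S : ∀ (M : Type u) [CommMonoid M] (S : Submonoid M), K M → K S
  /-- Closure under direct products. -/
  closed_P : ∀ (ι : Type u) (M : ι → Type u) [∀ i, CommMonoid (M i)],
    (∀ i, K (M i)) → K (∀ i, M i)

/-- The dominion of `A` in `B` relative to `K`: the elements of `B` on which any two homomorphisms
from `B` to a member of `K` agree as soon as they agree on `A`. -/
def CMonClass.dominion (K : CMonClass.{u}) {B : Type u} [CommMonoid B] (A : Submonoid B) : Set B :=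
  {b | ∀ (C : Type u) [CommMonoid C], K C → ∀ g h : B →* C,
    (∀ a ∈ A, g a = h a) → g b = h b}

/-- The relation defined in `B` by the conjunction of equations
`ψ_n(z_1, …, z_n, w_1, …, w_n, x_1, …, x_{2n+1}, y)`. Indices are shifted by one, so that
`z_i`, `w_i`, `x_j` are `z (i - 1)`, `w (i - 1)`, `x (j - 1)`; in the second case `n = k + 1`, and
`i : Fin k` stands for the index `i + 1 ∈ {1, …, n - 1}`. -/
def IsbellPsi {B : Type*} [Mul B] :
    (n : ℕ) → (z w : Fin n → B) → (x : Fin (2 * n + 1) → B) → (y : B) → Prop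
  | 0, _, _, x, y => x 0 = y
  | k + 1, z, w, x, y =>
    y = x ⟨0, by omega⟩ * z 0 ∧
    x ⟨0, by omega⟩ = w 0 * x ⟨1, by omega⟩ ∧
    (∀ i : Fin k, x ⟨2 * i + 1, by omega⟩ * z i.castSucc = x ⟨2 * i + 2, by omega⟩ * z i.succ) ∧
    (∀ i : Fin k, w i.castSucc * x ⟨2 * i + 2, by omega⟩ = w i.succ * x ⟨2 * i + 3, by omega⟩) ∧
    x ⟨2 * k + 1, by omega⟩ * z (Fin.last k) = x ⟨2 * k + 2, by omega⟩ ∧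
    w (Fin.last k) * x ⟨2 * k + 2, by omega⟩ = y

/-- Satisfaction in `B` of the `n`-th Isbell formula `φ_n(x_1, …, x_{2n+1}, y)`, which is
`∃ z_1, …, z_n, w_1, …, w_n, ψ_n`. -/
def IsbellPhi {B : Type*} [Mul B] (n : ℕ) (x : Fin (2 * n + 1) → B) (y : B) : Prop :=
  ∃ z w : Fin n → B, IsbellPsi n z w x y

/-!
For commutative monoids the pushout of two copies of `B` over `A` is the tensor product `B ⊗_A B`,
the quotient of `B × B` by the congruence generated by `(u * a, v) ∼ (u, a * v)` for `a ∈ A`. It is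
a homomorphic image of a power of `B`, so it lies in every variety containing `B`
(`CMonClass.IsVariety.quotient_prod`), and therefore the variety plays no further role: an element
`b` of the dominion must satisfy `(1, b) ∼ (b, 1)`, because the two coprojections agree on `A`.

The congruence is made explicit as the reflexive transitive closure of `IsbellStep A`, where one
step moves an element of `A` from the right factor to the left one and then another element of `A`
back. This relation is symmetric and compatible with multiplication, so its closure is already a
congruence, `isbellCon A`. A path from `(1, b)` to `(b, 1)` is, term by term, the system of
equations of an Isbell formula (`exists_isbellPhi_of_reflTransGen`).

Conversely, if `g` and `h` agree on `A`, then `g u * h v` takes the same value at all pairs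
`(u, v)` visited by a zigzag from `(1, b)` to `(b, 1)`, so `h b = g b` (`IsbellPsi.map_eq`).
-/

/-- The pair `p'` arises from `p` by moving some `a ∈ A` from the right component to the left one
and then some `a' ∈ A` back: `(u, a * z) ⇝ (u * a, z) = (u' * a', z) ⇝ (u', a' * z)`. -/
def IsbellStep {B : Type*} [CommMonoid B] (A : Submonoid B) (p p' : B × B) : Prop :=
  ∃ a ∈ A, ∃ a' ∈ A, ∃ z, p.2 = a * z ∧ p.1 * a = p'.1 * a' ∧ p'.2 = a' * z

namespace IsbellStep

variable {B : Type*} [CommMonoid B] {A : Submonoid B} {p p' : B × B}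

theorem refl (p : B × B) : IsbellStep A p p :=
  ⟨1, A.one_mem, 1, A.one_mem, p.2, by simp⟩

theorem symm (h : IsbellStep A p p') : IsbellStep A p' p := by
  obtain ⟨a, ha, a', ha', z, h₁, h₂, h₃⟩ := h
  exact ⟨a', ha', a, ha, z, h₃, h₂.symm, h₁⟩

theorem mul_left (q : B × B) (h : IsbellStep A p p') : IsbellStep A (q * p) (q * p') := by
  obtain ⟨a, ha, a', ha', z, h₁, h₂, h₃⟩ := h
  refine ⟨a, ha, a', ha', q.2 * z, ?_, ?_, ?_⟩
  · rw [Prod.snd_mul, h₁, mul_left_comm]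
  · rw [Prod.fst_mul, Prod.fst_mul, mul_assoc, h₂, mul_assoc]
  · rw [Prod.snd_mul, h₃, mul_left_comm]

end IsbellStep

/-- The congruence on `B × B` whose quotient is `B ⊗_A B`, the pushout of two copies of `B` over
`A` in commutative monoids. -/
def isbellCon {B : Type*} [CommMonoid B] (A : Submonoid B) : Con (B × B) where
  r := Relation.ReflTransGen (IsbellStep A)
  iseqv :=
    { refl := fun _ => .refl
      symm := fun h => by
        induction h with
        | refl => exact .refl
        | tail _ h ih => exact .head h.symm ih
      trans := .trans }
  mul' := by
    intro p p' q q' hp hq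
    have key (r : B × B) {s s' : B × B} (h : Relation.ReflTransGen (IsbellStep A) s s') :
        Relation.ReflTransGen (IsbellStep A) (r * s) (r * s') :=
      h.lift (r * ·) fun _ _ => .mul_left r
    have h := key q hp
    rw [mul_comm q, mul_comm q] at h
    exact h.trans (key p' hq)

/-- A variety containing `B` contains every quotient of `B × B`. -/
theorem CMonClass.IsVariety.quotient_prod {K : CMonClass.{u}} (hK : K.IsVariety) {B : Type u}
    [CommMonoid B] (hB : K B) (c : Con (B × B)) : K c.Quotient := by
  -- Products are indexed by types in universe `u`, so `B × B` is replaced by a power of `B`.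
  let f : (ULift.{u} Bool → B) →* B × B :=
    (Pi.evalMonoidHom (fun _ : ULift.{u} Bool => B) ⟨true⟩).prod
      (Pi.evalMonoidHom (fun _ : ULift.{u} Bool => B) ⟨false⟩)
  have hf : Function.Surjective f := fun p => ⟨fun i => if i.down then p.1 else p.2, by simp [f]⟩
  exact hK.closed_H _ _ (c.mk'.comp f) (c.mk'_surjective.comp hf)
    (hK.closed_P _ (fun _ : ULift.{u} Bool => B) fun _ => hB)

/-- A path of a reflexive relation, as an infinite sequence that stays at the endpoint. -/
theorem Relation.ReflTransGen.exists_seq {α : Type*} {r : α → α → Prop} (hr : ∀ x, r x x)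
    {p q : α} (h : Relation.ReflTransGen r p q) :
    ∃ (n : ℕ) (s : ℕ → α), s 0 = p ∧ s n = q ∧ ∀ i, r (s i) (s (i + 1)) := by
  induction h using Relation.ReflTransGen.head_induction_on with
  | refl => exact ⟨0, fun _ => q, rfl, rfl, fun _ => hr q⟩
  | @head a c hac _ ih =>
    obtain ⟨n, s, h₀, hn, hs⟩ := ih
    refine ⟨n + 1, fun i => i.casesOn a s, rfl, hn, fun i => ?_⟩
    cases i with
    | zero => exact (congrArg (r a) h₀).mpr hac
    | succ i => exact hs i

/-- Writing the `(i + 1)`-st pair of a path in `B × B` as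
`(w i, x (2 * i + 1) * z i) = (w i, x (2 * (i + 1)) * z (i + 1))`, with the `x j` in `A`, turns the
path into the equations of an Isbell formula. -/
theorem exists_isbellPhi_of_reflTransGen {B : Type*} [CommMonoid B] {A : Submonoid B} {b : B}
    (h : Relation.ReflTransGen (IsbellStep A) (1, b) (b, 1)) :
    ∃ (n : ℕ) (a : Fin (2 * n + 1) → B), (∀ i, a i ∈ A) ∧ IsbellPhi n a b := by
  obtain ⟨n, s, h₀, hn, hs⟩ := h.exists_seq IsbellStep.refl
  choose a ha a' ha' z h₁ h₂ h₃ using hs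
  -- The last `x` need not come from a step: the path ends at `(b, 1)`, so it is chosen to be `1`.
  let x (j : ℕ) : B := if j = 2 * n then 1 else if j % 2 = 0 then a (j / 2) else a' (j / 2)
  have hx_last : x (2 * n) = 1 := if_pos rfl
  have hx_even (i : ℕ) (hi : i < n) : x (2 * i) = a i := by
    simp only [x]
    rw [if_neg (by omega), if_pos (by omega), Nat.mul_div_cancel_left _ two_pos]
  have hx_odd (i : ℕ) : x (2 * i + 1) = a' i := by
    simp only [x]
    rw [if_neg (by omega), if_neg (by omega), show (2 * i + 1) / 2 = i by omega]
  refine ⟨n, fun j => x j, fun j => ?_, fun i => z i, fun i => (s (i + 1)).1, ?_⟩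
  · simp only [x]
    split_ifs
    exacts [A.one_mem, ha _, ha' _]
  cases n with
  | zero => exact hx_last.trans (congrArg Prod.fst (h₀.symm.trans hn))
  | succ k =>
    refine ⟨?_, ?_, fun i => ?_, fun i => ?_, ?_, ?_⟩
    · have := h₁ 0
      rw [h₀] at this
      exact this.trans (by rw [← hx_even 0 k.succ_pos]; rfl)
    · have := h₂ 0
      rw [h₀, one_mul, ← hx_even 0 k.succ_pos, ← hx_odd 0] at this
      exact this
    · change x (2 * i + 1) * z i = x (2 * (i + 1)) * z (i + 1)
      rw [hx_odd, hx_even _ (by omega), ← h₃, ← h₁]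
    · change (s (i + 1)).1 * x (2 * (i + 1)) = (s (i + 1 + 1)).1 * x (2 * (i + 1) + 1)
      rw [hx_odd, hx_even _ (by omega), h₂]
    · change x (2 * k + 1) * z k = x (2 * (k + 1))
      rw [hx_odd, hx_last, ← h₃, hn]
    · change (s (k + 1)).1 * x (2 * (k + 1)) = b
      rw [hx_last, hn, mul_one]

/-- Along a zigzag, `h b = g (w i) * h (x (2 * i + 1) * z i)` for every `i`; the last of these
values is `g b`. -/
theorem IsbellPsi.map_eq {B C : Type*} [CommMonoid B] [CommMonoid C] {n : ℕ} {z w : Fin n → B}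
    {x : Fin (2 * n + 1) → B} {b : B} (hψ : IsbellPsi n z w x b) {g h : B →* C}
    (hgh : ∀ i, g (x i) = h (x i)) : g b = h b := by
  cases n with
  | zero =>
    obtain rfl : x 0 = b := hψ
    exact hgh 0
  | succ k =>
    obtain ⟨e₁, e₂, e₃, e₄, e₅, e₆⟩ := hψ
    have key (i : Fin (k + 1)) : h b = g (w i) * h (x ⟨2 * i + 1, by omega⟩ * z i) := by
      induction i using Fin.induction with
      | zero =>
        rw [e₁, map_mul, ← hgh, e₂, map_mul, hgh, map_mul, mul_assoc]
        rfl
      | succ i ih =>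
        refine ih.trans ?_
        have e := congrArg g (e₄ i)
        rw [map_mul, map_mul, hgh, hgh] at e
        calc g (w i.castSucc) * h (x ⟨2 * i + 1, by omega⟩ * z i.castSucc)
            = g (w i.castSucc) * h (x ⟨2 * i + 2, by omega⟩) * h (z i.succ) := by
              rw [e₃ i, map_mul, mul_assoc]
          _ = g (w i.succ) * h (x ⟨2 * i + 3, by omega⟩ * z i.succ) := by
              rw [e, map_mul, mul_assoc]
    refine Eq.trans ?_ (key (Fin.last k)).symm
    refine Eq.trans ?_ (congrArg (g (w (Fin.last k)) * h ·) e₅.symm)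
    change g b = g (w (Fin.last k)) * h (x ⟨2 * k + 2, by omega⟩)
    rw [← hgh, ← map_mul, e₆]

theorem theorem3p2 (K : CMonClass.{u}) (hK : K.IsVariety)
    (B : Type u) [CommMonoid B] (hB : K B) (A : Submonoid B) (b : B) :
    b ∈ K.dominion A ↔
      ∃ (n : ℕ) (a : Fin (2 * n + 1) → B), (∀ i, a i ∈ A) ∧ IsbellPhi n a b := by
  constructor
  · intro hb
    refine exists_isbellPhi_of_reflTransGen ((isbellCon A).eq.mp ?_)
    refine hb (isbellCon A).Quotient (hK.quotient_prod hB _)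
      ((isbellCon A).mk'.comp (MonoidHom.inr B B)) ((isbellCon A).mk'.comp (MonoidHom.inl B B))
      fun a ha => (isbellCon A).eq.mpr (.single ?_)
    exact ⟨a, ha, 1, A.one_mem, 1, by simp⟩
  · rintro ⟨n, a, ha, z, w, hψ⟩ C _ _ g h hgh
    exact hψ.map_eq fun i => hgh _ (ha i)
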